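/- Let $d\ge 1$ be an integer and $0<\alpha<2$. For a function $u:\mathbb{R}^d\to\mathbb{R}$ the integral fractional Laplacian is $$(-\Delta)^{\alpha/2}u(x)=c_{d,\alpha}\int_{\mathbb{R}^d}\frac{u(x)-u(y)}{|x-y|^{d+\alpha}}\,dy,\qquad c_{d,\alpha}=\frac{2^{\alpha}\,\Gamma\!\left(\frac{\alpha+d}{2}\right)}{\pi^{d/2}\,|\Gamma(-\alpha/2)|},$$ where $|\cdot|$ is the Euclidean norm and the integral is a Lebesgue integral if $\alpha<1$ and a Cauchy principal value at $y=x$, that is $\lim_{\varepsilon\downarrow0}\int_{|x-y|>\varepsilon}$, if $\alpha\ge1$. Let $$\Phi_{d,\alpha}(x)=(1+|x|^2)^{\frac{\alpha-d}{2}},\qquad \Phi_{d,-\alpha}(x)=(1+|x|^2)^{-\frac{\alpha+d}{2}},\qquad \mu_{d,\alpha}=\frac{2^{\alpha}\,\Gamma\!\left(\frac{d+\alpha}{2}\right)}{\Gamma\!\left(\frac{d-\alpha}{2}\right)}.$$ If $d-\alpha>0$, or $d-\alpha$ is not an even integer, then for every $x\in\mathbb{R}^d$ the integral defining $(-\Delta)^{\alpha/2}\Phi_{d,\alpha}(x)$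 converges (absolutely if $\alpha<1$; if $\alpha\ge1$, absolutely outside every ball around $x$ and as a principal value), and $$(-\Delta)^{\alpha/2}\Phi_{d,\alpha}(x)=\mu_{d,\alpha}\,\Phi_{d,-\alpha}(x).$$ -/

import Mathlib

open MeasureTheory Filter Topology

/-- The normalising constant `c_{d,α} = 2^α Γ((α+d)/2) / (π^{d/2} |Γ(-α/2)|)` of the integral
fractional Laplacian of order `α` on `ℝ^d`. -/
noncomputable def fracLapConst (d : ℕ) (α : ℝ) : ℝ :=
  (2 : ℝ) ^ α * Real.Gamma ((α + d) / 2) / (Real.pi ^ ((d : ℝ) / 2) * |Real.Gamma (-α / 2)|)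

/-- The integrand `y ↦ (u(x) - u(y)) / |x - y|^{d+α}` of the integral fractional Laplacian. -/
noncomputable def fracLapIntegrand {d : ℕ} (α : ℝ) (u : EuclideanSpace ℝ (Fin d) → ℝ)
    (x y : EuclideanSpace ℝ (Fin d)) : ℝ :=
  (u x - u y) / ‖x - y‖ ^ ((d : ℝ) + α)

/-- `f` has the Cauchy principal value `I` at the singularity `x`: `f` is Lebesgue integrable
outside every ball around `x`, and the integrals over `{|x - y| > ε}` converge to `I` as `ε ↓ 0`. -/
def HasPrincipalValueAt {d : ℕ} (f : EuclideanSpace ℝ (Fin d) → ℝ)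
    (x : EuclideanSpace ℝ (Fin d)) (I : ℝ) : Prop :=
  (∀ ε : ℝ, 0 < ε → IntegrableOn f {y | ε < ‖x - y‖} volume) ∧
    Tendsto (fun ε : ℝ => ∫ y in {y | ε < ‖x - y‖}, f y) (𝓝[>] 0) (𝓝 I)

/-- The integral fractional Laplacian `(-Δ)^{α/2} u`, `0 < α < 2`, is well defined at `x` and has
the value `L` there: `L = c_{d,α} ∫ (u(x) - u(y)) / |x - y|^{d+α} dy`, where the integral is an
absolutely convergent Lebesgue integral if `α < 1` and a Cauchy principal value if `1 ≤ α`. -/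
def HasFracLaplacianAt {d : ℕ} (α : ℝ) (u : EuclideanSpace ℝ (Fin d) → ℝ) (L : ℝ)
    (x : EuclideanSpace ℝ (Fin d)) : Prop :=
  (α < 1 → Integrable (fracLapIntegrand α u x) volume ∧
    L = fracLapConst d α * ∫ y, fracLapIntegrand α u x y) ∧
  (1 ≤ α → ∃ I : ℝ, HasPrincipalValueAt (fracLapIntegrand α u x) x I ∧
    L = fracLapConst d α * I)

/-- The generalized multiquadric `Φ_{d,α}(x) = (1 + |x|²)^{α/2 - d/2}`. -/
noncomputable def gmq (d : ℕ) (α : ℝ) (x : EuclideanSpace ℝ (Fin d)) : ℝ :=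
  (1 + ‖x‖ ^ 2) ^ (α / 2 - (d : ℝ) / 2)

/-- The constant `μ_{d,α} = 2^α Γ(d/2 + α/2) / Γ(d/2 - α/2)`. -/
noncomputable def gmqConst (d : ℕ) (α : ℝ) : ℝ :=
  (2 : ℝ) ^ α * Real.Gamma ((d : ℝ) / 2 + α / 2) / Real.Gamma ((d : ℝ) / 2 - α / 2)

/-!
The proof superposes Gaussians, on the Fourier side. Put `s = (d - α) / 2` and `a = α / 2`. By
`integral_rpow_mul_exp_sub_exp`,
`Γ(s) (Φ(x) - Φ(y)) = ∫₀^∞ t^(s-1) (e^(-t(1+‖x‖²)) - e^(-t(1+‖y‖²))) dt`. This formula for the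
*difference* holds for every `s > -1`, `s ≠ 0`, hence also in the case `d = 1 < α`, in which the
multiquadric grows at infinity. Writing each Gaussian as a Fourier integral over `ξ` turns the
second-order difference `Φ(x) - (Φ(x+z) + Φ(x-z)) / 2` into the integral over `(ξ, t)` of
`besselKernel a t ξ * cos ⟪x,ξ⟫ * (1 - cos ⟪z,ξ⟫)`, up to a constant. Two facts finish the
computation:

* `∫ (1 - cos ⟪z,ξ⟫) / ‖z‖^(d+α) dz = ‖ξ‖^α / c_{d,α}` (`integral_one_sub_cos_div_norm_rpow`);
* the substitution `t ↦ ‖ξ‖² / (4t)` exchanges the kernels of orders `a` and `-a`, up to the factor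
  `(‖ξ‖ / 2)^α` (`integral_besselKernel_neg`). The symbol `‖ξ‖^α` is thus absorbed, and the kernel
  of order `-a` gives back the multiquadric `Φ_{d,-α}`.

As `1 - cos ≥ 0`, the triple integral over `(z, ξ, t)` converges absolutely. Fubini's theorem
therefore yields both the integrability of the second-order difference quotient and its integral
(`integral_symm_difference_gmq`), for all `0 < α < 2`. The integral of the first-order quotient over
a set symmetric about `x` equals that of the second-order one, so the principal value exists by
dominated convergence. For `α < 1` the first-order quotient itself is integrable, because the
multiquadric is differentiable.
-/

open Set Real

/-! ### Fourier transforms of Gaussians -/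

section Gaussian

variable {V : Type*} [NormedAddCommGroup V] [InnerProductSpace ℝ V] [FiniteDimensional ℝ V]
  [MeasurableSpace V] [BorelSpace V]

theorem integrable_exp_neg_mul_norm_sq {b : ℝ} (hb : 0 < b) :
    Integrable (fun v : V => exp (-b * ‖v‖ ^ 2)) := by
  have h := (GaussianFourier.integrable_cexp_neg_mul_sq_norm_add (V := V) (b := (b : ℂ))
    (by simpa using hb) 0 0).re
  refine h.congr (Eventually.of_forall fun v => ?_)
  have : -(b : ℂ) * (‖v‖ : ℂ) ^ 2 + 0 * ((inner ℝ (0 : V) v : ℝ) : ℂ)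
      = ((-b * ‖v‖ ^ 2 : ℝ) : ℂ) := by push_cast; ring
  simp only [this]
  exact Complex.exp_ofReal_re _

theorem integrable_exp_neg_mul_norm_sq_mul_cos {b : ℝ} (hb : 0 < b) (w : V) :
    Integrable (fun v : V => exp (-b * ‖v‖ ^ 2) * cos (inner ℝ w v)) := by
  refine (integrable_exp_neg_mul_norm_sq hb).mono (by fun_prop) (Eventually.of_forall fun v => ?_)
  rw [norm_mul]
  exact mul_le_of_le_one_right (norm_nonneg _) (abs_cos_le_one _)

/-- The Fourier transform of a Gaussian, in its real form. -/
theorem integral_exp_neg_mul_norm_sq_mul_cos {b : ℝ} (hb : 0 < b) (w : V) :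
    ∫ v : V, exp (-b * ‖v‖ ^ 2) * cos (inner ℝ w v)
      = (π / b) ^ ((Module.finrank ℝ V : ℝ) / 2) * exp (-‖w‖ ^ 2 / (4 * b)) := by
  have h := GaussianFourier.integral_cexp_neg_mul_sq_norm_add (V := V) (b := (b : ℂ))
    (by simpa using hb) Complex.I w
  have hi := GaussianFourier.integrable_cexp_neg_mul_sq_norm_add (V := V) (b := (b : ℂ))
    (by simpa using hb) Complex.I w
  have h2 := congrArg Complex.re h
  have h3 := integral_re hi
  simp only [RCLike.re_eq_complex_re] at h3
  rw [← h3] at h2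
  have e1 : ∀ v : V, (Complex.exp (-(b : ℂ) * (‖v‖ : ℂ) ^ 2
      + Complex.I * ((inner ℝ w v : ℝ) : ℂ))).re = exp (-b * ‖v‖ ^ 2) * cos (inner ℝ w v) := by
    intro v
    rw [Complex.exp_re]
    congr 2 <;> simp [← Complex.ofReal_pow]
  simp only [e1] at h2
  rw [h2]
  have e2 : (π / b : ℂ) ^ ((Module.finrank ℝ V : ℂ) / 2)
      = (((π / b) ^ ((Module.finrank ℝ V : ℝ) / 2) : ℝ) : ℂ) := by
    rw [Complex.ofReal_cpow (by positivity)]; push_cast; rfl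
  have e3 : Complex.exp (Complex.I ^ 2 * (‖w‖ : ℂ) ^ 2 / (4 * b))
      = ((exp (-‖w‖ ^ 2 / (4 * b)) : ℝ) : ℂ) := by
    rw [Complex.I_sq]; push_cast; ring_nf
  rw [e2, e3, ← Complex.ofReal_mul, Complex.ofReal_re]

theorem integral_exp_neg_mul_norm_sq {b : ℝ} (hb : 0 < b) :
    ∫ v : V, exp (-b * ‖v‖ ^ 2) = (π / b) ^ ((Module.finrank ℝ V : ℝ) / 2) := by
  simpa using integral_exp_neg_mul_norm_sq_mul_cos hb (0 : V)

end Gaussian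

/-! ### Gamma integrals -/

section Gamma

theorem integrableOn_rpow_mul_exp_neg_mul {p r : ℝ} (hp : 0 < p) (hr : 0 < r) :
    IntegrableOn (fun t : ℝ => t ^ (p - 1) * exp (-(r * t))) (Ioi 0) := by
  have := integrableOn_rpow_mul_exp_neg_mul_rpow (p := 1) (s := p - 1) (b := r) (by linarith)
    one_pos hr
  simpa using this

theorem integral_rpow_mul_exp_neg_mul {p r : ℝ} (hp : 0 < p) (hr : 0 < r) :
    ∫ t in Ioi (0 : ℝ), t ^ (p - 1) * exp (-(r * t)) = r ^ (-p) * Gamma p := by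
  rw [Real.integral_rpow_mul_exp_neg_mul_Ioi hp hr, one_div, inv_rpow hr.le, rpow_neg hr.le]

/-- The difference of two powers as a Gamma integral. The difference of the exponentials vanishes
at `t = 0`, which allows every exponent `s > -1`. The case `A = 0`, `s < 0` is included, where
`A ^ (-s) = 0`. -/
theorem integral_rpow_mul_exp_sub_exp_of_le {s A B : ℝ} (hs : -1 < s) (hs0 : s ≠ 0) (hA : 0 ≤ A)
    (hAB : A ≤ B) (h : 0 < A ∨ s < 0) :
    IntegrableOn (fun t : ℝ => t ^ (s - 1) * (exp (-(A * t)) - exp (-(B * t)))) (Ioi 0) ∧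
    ∫ t in Ioi (0 : ℝ), t ^ (s - 1) * (exp (-(A * t)) - exp (-(B * t)))
      = Gamma s * (A ^ (-s) - B ^ (-s)) := by
  have hpos : ∀ r ∈ Ioc A B, 0 < r := fun r hr => hA.trans_lt hr.1
  have hG : ∀ r ∈ Ioc A B, ∫ t in Ioi (0 : ℝ), t ^ s * exp (-(r * t))
      = r ^ (-s - 1) * Gamma (s + 1) := by
    intro r hr
    have := integral_rpow_mul_exp_neg_mul (p := s + 1) (by linarith) (hpos r hr)
    rw [show -s - 1 = -(s + 1) by ring, ← this]
    simp
  -- `t ^ (s - 1) * (exp (-A t) - exp (-B t))` is the integral of `t ^ s * exp (-r t)` over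
  -- `A < r ≤ B`, and this function of `(r, t)` is nonnegative.
  have hint : Integrable (fun q : ℝ × ℝ => q.2 ^ s * exp (-(q.1 * q.2)))
      ((volume.restrict (Ioc A B)).prod (volume.restrict (Ioi 0))) := by
    rw [integrable_prod_iff (by fun_prop)]
    constructor
    · filter_upwards [ae_restrict_mem measurableSet_Ioc] with r hr
      simpa [IntegrableOn] using
        integrableOn_rpow_mul_exp_neg_mul (p := s + 1) (by linarith) (hpos r hr)
    · have h1 : IntegrableOn (fun r : ℝ => r ^ (-s - 1) * Gamma (s + 1)) (Ioc A B) := by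
        refine Integrable.mul_const ?_ _
        rw [← IntegrableOn, ← intervalIntegrable_iff_integrableOn_Ioc_of_le hAB]
        rcases h with h | h
        · refine intervalIntegral.intervalIntegrable_rpow (Or.inr ?_)
          rw [uIcc_of_le hAB]
          exact fun h0 => absurd h0.1 (not_le.2 h)
        · exact intervalIntegral.intervalIntegrable_rpow' (by linarith)
      refine h1.congr ?_
      filter_upwards [ae_restrict_mem measurableSet_Ioc] with r hr
      rw [← hG r hr]
      refine setIntegral_congr_fun measurableSet_Ioi fun t ht => ?_
      exact (norm_of_nonneg (mul_nonneg (rpow_nonneg (le_of_lt ht) _) (exp_pos _).le)).symm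
  have hin : ∀ t ∈ Ioi (0 : ℝ), ∫ r in Ioc A B, t ^ s * exp (-(r * t))
      = t ^ (s - 1) * (exp (-(A * t)) - exp (-(B * t))) := by
    intro t ht
    have ht : 0 < t := ht
    rw [← intervalIntegral.integral_of_le hAB]
    have hd : ∀ r ∈ uIcc A B, HasDerivAt (fun r => -(t ^ (s - 1) * exp (-(r * t))))
        (t ^ s * exp (-(r * t))) r := by
      intro r _
      have h1 := ((((hasDerivAt_id r).mul_const t).neg.exp).const_mul (t ^ (s - 1))).neg
      refine h1.congr_deriv ?_
      rw [rpow_sub_one ht.ne']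
      field_simp
      simp
    rw [intervalIntegral.integral_eq_sub_of_hasDerivAt hd
      (Continuous.intervalIntegrable (by fun_prop) _ _)]
    ring
  constructor
  · refine hint.integral_prod_right.congr ?_
    filter_upwards [ae_restrict_mem measurableSet_Ioi] with t ht
    exact hin t ht
  · rw [← setIntegral_congr_fun measurableSet_Ioi hin,
      ← integral_integral_swap (f := fun r t : ℝ => t ^ s * exp (-(r * t))) hint,
      setIntegral_congr_fun measurableSet_Ioc hG, integral_mul_const,
      ← intervalIntegral.integral_of_le hAB, integral_rpow, Gamma_add_one hs0]
    · rw [show -s - 1 + 1 = -s by ring]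
      field_simp
      ring
    · rcases h with h | h
      · refine Or.inr ⟨fun h0 => hs0 (by linarith), ?_⟩
        rw [uIcc_of_le hAB]
        exact fun h0 => absurd h0.1 (not_le.2 h)
      · exact Or.inl (by linarith)

theorem integral_rpow_mul_exp_sub_exp {s A B : ℝ} (hs : -1 < s) (hs0 : s ≠ 0) (hA : 0 < A)
    (hB : 0 < B) :
    IntegrableOn (fun t : ℝ => t ^ (s - 1) * (exp (-(A * t)) - exp (-(B * t)))) (Ioi 0) ∧
    ∫ t in Ioi (0 : ℝ), t ^ (s - 1) * (exp (-(A * t)) - exp (-(B * t)))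
      = Gamma s * (A ^ (-s) - B ^ (-s)) := by
  rcases le_total A B with h | h
  · exact integral_rpow_mul_exp_sub_exp_of_le hs hs0 hA.le h (Or.inl hA)
  · obtain ⟨h1, h2⟩ := integral_rpow_mul_exp_sub_exp_of_le hs hs0 hB.le h (Or.inl hB)
    have e : ∀ t : ℝ, t ^ (s - 1) * (exp (-(A * t)) - exp (-(B * t)))
        = -(t ^ (s - 1) * (exp (-(B * t)) - exp (-(A * t)))) := fun t => by ring
    simp only [e]
    refine ⟨h1.neg, ?_⟩
    rw [integral_neg, h2]
    ring

/-- The substitution `t ↦ k / t` on the half-line. -/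
theorem integral_Ioi_comp_div {k : ℝ} (hk : 0 < k) (g : ℝ → ℝ) :
    (IntegrableOn (fun t => t ^ (-2 : ℝ) * g (k / t)) (Ioi 0) ↔ IntegrableOn g (Ioi 0)) ∧
    ∫ t in Ioi (0 : ℝ), t ^ (-2 : ℝ) * g (k / t) = k⁻¹ * ∫ t in Ioi (0 : ℝ), g t := by
  have e : ∀ t ∈ Ioi (0 : ℝ), t ^ (-2 : ℝ) * g (k / t)
      = (|(-1 : ℝ)| * t ^ ((-1 : ℝ) - 1)) • (fun u => g (k * u)) (t ^ (-1 : ℝ)) := by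
    intro t _
    rw [rpow_neg_one]
    norm_num [div_eq_mul_inv]
  constructor
  · rw [integrableOn_congr_fun e measurableSet_Ioi,
      integrableOn_Ioi_comp_rpow_iff (fun u => g (k * u)) (by norm_num),
      integrableOn_Ioi_comp_mul_left_iff g 0 hk, mul_zero]
  · rw [setIntegral_congr_fun measurableSet_Ioi e,
      integral_comp_rpow_Ioi (fun u => g (k * u)) (by norm_num),
      integral_comp_mul_left_Ioi g 0 hk, mul_zero, smul_eq_mul]

end Gamma

/-! ### The symbol of the fractional Laplacian -/

section Symbol

theorem abs_Gamma_neg {a : ℝ} (h0 : 0 < a) (h1 : a < 1) : |Gamma (-a)| = -Gamma (-a) := by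
  have h := Gamma_add_one (s := -a) (by linarith)
  have h2 : 0 < Gamma (-a + 1) := Gamma_pos_of_pos (by linarith)
  rw [abs_of_neg]
  by_contra hc
  nlinarith

theorem fracLapConst_pos {d : ℕ} {α : ℝ} (hα0 : 0 < α) (hα2 : α < 2) : 0 < fracLapConst d α := by
  have h : 0 < |Gamma (-α / 2)| := by
    have h := Gamma_add_one (s := -α / 2) (by linarith)
    have h2 : 0 < Gamma (-α / 2 + 1) := Gamma_pos_of_pos (by linarith)
    exact abs_pos.2 fun h0 => by rw [h0] at h; linarith
  have h3 : 0 < Gamma ((α + d) / 2) := Gamma_pos_of_pos (by positivity)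
  unfold fracLapConst
  positivity

theorem integral_rpow_mul_one_sub_exp_neg_div {a k : ℝ} (h0 : 0 < a) (h1 : a < 1) (hk : 0 ≤ k) :
    IntegrableOn (fun t : ℝ => t ^ (a - 1) * (1 - exp (-(k / t)))) (Ioi 0) ∧
    ∫ t in Ioi (0 : ℝ), t ^ (a - 1) * (1 - exp (-(k / t))) = |Gamma (-a)| * k ^ a := by
  obtain ⟨hi, he⟩ := integral_rpow_mul_exp_sub_exp_of_le (s := -a) (A := 0) (B := k)
    (by linarith) (by linarith) le_rfl hk (Or.inr (by linarith))
  obtain ⟨si, se⟩ := integral_Ioi_comp_div one_pos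
    (fun t : ℝ => t ^ (-a - 1) * (exp (-(0 * t)) - exp (-(k * t))))
  have e : ∀ t ∈ Ioi (0 : ℝ),
      t ^ (-2 : ℝ) * ((1 / t) ^ (-a - 1) * (exp (-(0 * (1 / t))) - exp (-(k * (1 / t)))))
        = t ^ (a - 1) * (1 - exp (-(k / t))) := by
    intro t ht
    have ht : 0 < t := ht
    rw [one_div, inv_rpow ht.le, ← rpow_neg ht.le, ← mul_assoc, ← rpow_add ht]
    simp only [zero_mul, neg_zero, exp_zero, div_eq_mul_inv]
    ring_nf
  rw [integrableOn_congr_fun e measurableSet_Ioi] at si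
  rw [setIntegral_congr_fun measurableSet_Ioi e] at se
  refine ⟨si.2 hi, ?_⟩
  rw [se, he, abs_Gamma_neg h0 h1, neg_neg, zero_rpow h0.ne']
  ring

/-- `ξ ↦ ‖ξ‖ ^ α` is the Fourier symbol of the fractional Laplacian. -/
theorem integral_one_sub_cos_div_norm_rpow {d : ℕ} {α : ℝ} (hα0 : 0 < α) (hα2 : α < 2)
    (ξ : EuclideanSpace ℝ (Fin d)) :
    Integrable (fun z => (1 - cos (inner ℝ ξ z)) / ‖z‖ ^ ((d : ℝ) + α)) ∧
    ∫ z, (1 - cos (inner ℝ ξ z)) / ‖z‖ ^ ((d : ℝ) + α) = ‖ξ‖ ^ α / fracLapConst d α := by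
  set p : ℝ := (α + d) / 2 with hp
  have hp0 : 0 < p := by positivity
  have hΓ : 0 < Gamma p := Gamma_pos_of_pos hp0
  -- The factor `‖z‖ ^ (-(d + α))` is written as a superposition of Gaussians.
  let H : EuclideanSpace ℝ (Fin d) → ℝ → ℝ := fun z τ =>
    (1 - cos (inner ℝ ξ z)) * (τ ^ (p - 1) * exp (-(‖z‖ ^ 2 * τ)))
  have hz : ∀ z, ∫ τ in Ioi (0 : ℝ), H z τ
      = Gamma p * ((1 - cos (inner ℝ ξ z)) / ‖z‖ ^ ((d : ℝ) + α)) := by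
    intro z
    simp only [H]
    rw [integral_const_mul]
    rcases eq_or_ne z 0 with rfl | hz
    · simp
    · have hz : 0 < ‖z‖ := norm_pos_iff.2 hz
      rw [integral_rpow_mul_exp_neg_mul hp0 (by positivity), ← rpow_natCast, ← rpow_mul hz.le,
        show ((2 : ℕ) : ℝ) * -p = -(d + α) by rw [hp]; push_cast; ring, rpow_neg hz.le]
      field_simp
  have hτi : ∀ τ ∈ Ioi (0 : ℝ), Integrable (fun z => H z τ) := by
    intro τ hτ
    have := (((integrable_exp_neg_mul_norm_sq (V := EuclideanSpace ℝ (Fin d)) hτ).sub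
      (integrable_exp_neg_mul_norm_sq_mul_cos hτ ξ)).const_mul (τ ^ (p - 1)))
    refine this.congr (Eventually.of_forall fun z => ?_)
    simp only [H, Pi.sub_apply]
    rw [show -τ * ‖z‖ ^ 2 = -(‖z‖ ^ 2 * τ) by ring]
    ring
  have hτ : ∀ τ ∈ Ioi (0 : ℝ), ∫ z, H z τ
      = π ^ ((d : ℝ) / 2) * (τ ^ (α / 2 - 1) * (1 - exp (-(‖ξ‖ ^ 2 / 4 / τ)))) := by
    intro τ hτ
    have hτ : 0 < τ := hτ
    have e : ∀ z, H z τ = τ ^ (p - 1) * (exp (-τ * ‖z‖ ^ 2)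
        - exp (-τ * ‖z‖ ^ 2) * cos (inner ℝ ξ z)) := by
      intro z
      simp only [H]
      rw [show -τ * ‖z‖ ^ 2 = -(‖z‖ ^ 2 * τ) by ring]
      ring
    simp only [e]
    rw [integral_const_mul, integral_sub (integrable_exp_neg_mul_norm_sq hτ)
      (integrable_exp_neg_mul_norm_sq_mul_cos hτ ξ), integral_exp_neg_mul_norm_sq hτ,
      integral_exp_neg_mul_norm_sq_mul_cos hτ ξ, finrank_euclideanSpace_fin,
      div_rpow pi_pos.le hτ.le, show p - 1 = (α / 2 - 1) + (d : ℝ) / 2 by rw [hp]; ring,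
      rpow_add hτ, show -‖ξ‖ ^ 2 / (4 * τ) = -(‖ξ‖ ^ 2 / 4 / τ) by field_simp]
    field_simp
  have hH0 : ∀ z, ∀ τ ∈ Ioi (0 : ℝ), 0 ≤ H z τ := fun z τ hτ =>
    mul_nonneg (sub_nonneg.2 (cos_le_one _))
      (mul_nonneg (rpow_nonneg (le_of_lt hτ) _) (exp_pos _).le)
  obtain ⟨gi, ge⟩ := integral_rpow_mul_one_sub_exp_neg_div (a := α / 2) (k := ‖ξ‖ ^ 2 / 4)
    (by linarith) (by linarith) (by positivity)
  have hint : Integrable (Function.uncurry H) (volume.prod (volume.restrict (Ioi 0))) := by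
    rw [integrable_prod_iff' (by simp only [H, Function.uncurry_def]; fun_prop)]
    constructor
    · filter_upwards [ae_restrict_mem measurableSet_Ioi] with τ h using hτi τ h
    · refine (gi.const_mul (π ^ ((d : ℝ) / 2))).congr ?_
      filter_upwards [ae_restrict_mem measurableSet_Ioi] with τ h
      rw [← hτ τ h]
      exact integral_congr_ae (Eventually.of_forall fun z => (norm_of_nonneg (hH0 z τ h)).symm)
  have h1 := hint.integral_prod_left
  have h2 := integral_integral_swap hint
  simp only [Function.uncurry_apply_pair, hz] at h1 h2
  constructor
  · simpa [← mul_assoc, hΓ.ne'] using h1.const_mul (Gamma p)⁻¹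
  · rw [setIntegral_congr_fun measurableSet_Ioi hτ, integral_const_mul, integral_const_mul, ge,
      div_rpow (by positivity) (by norm_num), ← rpow_natCast, ← rpow_mul (norm_nonneg _),
      show (4 : ℝ) = 2 ^ (2 : ℝ) by norm_num, ← rpow_mul (by norm_num),
      show ((2 : ℕ) : ℝ) * (α / 2) = α by push_cast; ring,
      show (2 : ℝ) * (α / 2) = α by ring] at h2
    rw [← mul_right_inj' hΓ.ne', h2, fracLapConst, ← hp, neg_div]
    have : (0 : ℝ) < 2 ^ α := by positivity
    field_simp

end Symbol

/-! ### The Bessel kernel -/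

section BesselKernel

/-- The kernel that superposes Gaussians in `ξ` to the Fourier transform of a multiquadric. Up to
constants its integral over `t > 0` is `‖ξ‖ ^ (-a) * K_a(‖ξ‖)`, with the Bessel function `K_a`. -/
noncomputable def besselKernel {V : Type*} [Norm V] (a t : ℝ) (ξ : V) : ℝ :=
  t ^ (-a - 1) * exp (-t) * exp (-(‖ξ‖ ^ 2 / 4 / t))

/-- The symmetry of the Bessel kernel in its order, from the substitution `t ↦ ‖ξ‖² / (4t)`. -/
theorem integral_besselKernel_neg {V : Type*} [NormedAddCommGroup V] (a : ℝ) {ξ : V} (hξ : ξ ≠ 0) :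
    (IntegrableOn (fun t => ‖ξ‖ ^ (2 * a) * besselKernel a t ξ) (Ioi 0) ↔
      IntegrableOn (fun t => besselKernel (-a) t ξ) (Ioi 0)) ∧
    ∫ t in Ioi (0 : ℝ), ‖ξ‖ ^ (2 * a) * besselKernel a t ξ
      = 2 ^ (2 * a) * ∫ t in Ioi (0 : ℝ), besselKernel (-a) t ξ := by
  have hξ : 0 < ‖ξ‖ := norm_pos_iff.2 hξ
  have hk : 0 < ‖ξ‖ ^ 2 / 4 := by positivity
  obtain ⟨si, se⟩ := integral_Ioi_comp_div hk (fun t => besselKernel (-a) t ξ)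
  set k := ‖ξ‖ ^ 2 / 4 with hkdef
  have hka : ‖ξ‖ ^ (2 * a) = 2 ^ (2 * a) * k ^ a := by
    rw [hkdef, div_rpow (by positivity) (by norm_num), ← rpow_natCast, ← rpow_mul hξ.le,
      show (4 : ℝ) = 2 ^ (2 : ℝ) by norm_num, ← rpow_mul (by norm_num)]
    have : (0 : ℝ) < 2 ^ (2 * a) := by positivity
    push_cast
    field_simp
  have e : ∀ t ∈ Ioi (0 : ℝ), t ^ (-2 : ℝ) * besselKernel (-a) (k / t) ξ
      = (2 ^ (2 * a) * k)⁻¹ * (‖ξ‖ ^ (2 * a) * besselKernel a t ξ) := by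
    intro t ht
    have ht : 0 < t := ht
    have h2 : (0 : ℝ) < 2 ^ (2 * a) := by positivity
    simp only [besselKernel, ← hkdef]
    rw [div_rpow hk.le ht.le, hka, show k / (k / t) = t by field_simp, neg_neg,
      show -a - 1 = -2 - (a - 1) by ring, rpow_sub ht (-2), rpow_sub_one hk.ne']
    field_simp
  rw [integrableOn_congr_fun e measurableSet_Ioi] at si
  rw [setIntegral_congr_fun measurableSet_Ioi e, integral_const_mul] at se
  constructor
  · rw [← si]
    exact (integrable_const_mul_iff (IsUnit.mk0 _ (by positivity)) _).symm
  · have h2 : (0 : ℝ) < 2 ^ (2 * a) := by positivity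
    field_simp at se
    exact se

end BesselKernel

/-! ### The second-order difference quotient of the multiquadric -/

section Fubini

variable {d : ℕ}

theorem integrable_besselKernel_mul_cos (a : ℝ) {t : ℝ} (ht : 0 < t)
    (w : EuclideanSpace ℝ (Fin d)) :
    Integrable (fun ξ => besselKernel a t ξ * cos (inner ℝ w ξ)) := by
  have hb : 0 < (4 * t)⁻¹ := by positivity
  refine ((integrable_exp_neg_mul_norm_sq_mul_cos hb w).const_mul
    (t ^ (-a - 1) * exp (-t))).congr (Eventually.of_forall fun ξ => ?_)
  simp only [besselKernel]
  rw [show -(‖ξ‖ ^ 2 / 4 / t) = -(4 * t)⁻¹ * ‖ξ‖ ^ 2 by field_simp]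
  ring

theorem integral_besselKernel_mul_cos (a : ℝ) {t : ℝ} (ht : 0 < t)
    (w : EuclideanSpace ℝ (Fin d)) :
    ∫ ξ, besselKernel a t ξ * cos (inner ℝ w ξ)
      = (4 * π) ^ ((d : ℝ) / 2) * (t ^ ((d : ℝ) / 2 - a - 1) * exp (-((1 + ‖w‖ ^ 2) * t))) := by
  have hb : 0 < (4 * t)⁻¹ := by positivity
  have e : ∀ ξ : EuclideanSpace ℝ (Fin d), besselKernel a t ξ * cos (inner ℝ w ξ)
      = (t ^ (-a - 1) * exp (-t)) * (exp (-(4 * t)⁻¹ * ‖ξ‖ ^ 2) * cos (inner ℝ w ξ)) := by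
    intro ξ
    simp only [besselKernel]
    rw [show -(‖ξ‖ ^ 2 / 4 / t) = -(4 * t)⁻¹ * ‖ξ‖ ^ 2 by field_simp]
    ring
  simp only [e]
  rw [integral_const_mul, integral_exp_neg_mul_norm_sq_mul_cos hb, finrank_euclideanSpace_fin,
    show π / (4 * t)⁻¹ = (4 * π) * t by field_simp, mul_rpow (by positivity) ht.le,
    show -‖w‖ ^ 2 / (4 * (4 * t)⁻¹) = -(‖w‖ ^ 2 * t) by field_simp,
    show (d : ℝ) / 2 - a - 1 = (-a - 1) + (d : ℝ) / 2 by ring, rpow_add ht,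
    show -((1 + ‖w‖ ^ 2) * t) = -t + -(‖w‖ ^ 2 * t) by ring, exp_add]
  ring

theorem besselKernel_nonneg (a : ℝ) {t : ℝ} (ht : 0 < t) (ξ : EuclideanSpace ℝ (Fin d)) :
    0 ≤ besselKernel a t ξ := by
  unfold besselKernel; positivity

theorem measurable_besselKernel (a : ℝ) :
    Measurable (fun q : EuclideanSpace ℝ (Fin d) × ℝ => besselKernel a q.2 q.1) := by
  unfold besselKernel; fun_prop

/-- The integral over `ξ` is a Gamma integrand of exponent `d / 2 + a > 0`. -/
theorem integrable_besselKernel_neg {a : ℝ} (ha : 0 < a) :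
    Integrable (fun q : EuclideanSpace ℝ (Fin d) × ℝ => besselKernel (-a) q.2 q.1)
      (volume.prod (volume.restrict (Ioi 0))) := by
  rw [integrable_prod_iff' (measurable_besselKernel _).aestronglyMeasurable]
  constructor
  · filter_upwards [ae_restrict_mem measurableSet_Ioi] with t ht
    simpa using integrable_besselKernel_mul_cos (-a) ht (0 : EuclideanSpace ℝ (Fin d))
  · have hp : 0 < (d : ℝ) / 2 + a := by positivity
    refine ((integrableOn_rpow_mul_exp_neg_mul hp one_pos).const_mul
      ((4 * π) ^ ((d : ℝ) / 2))).congr ?_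
    filter_upwards [ae_restrict_mem measurableSet_Ioi] with t ht
    have := integral_besselKernel_mul_cos (-a) ht (0 : EuclideanSpace ℝ (Fin d))
    simp only [inner_zero_left, cos_zero, mul_one, norm_zero] at this
    norm_num at this
    simp only [norm_of_nonneg (besselKernel_nonneg (-a) ht _), this, one_mul]

theorem ae_ne_zero (hd : 1 ≤ d) : ∀ᵐ ξ : EuclideanSpace ℝ (Fin d), ξ ≠ 0 := by
  have : Nonempty (Fin d) := ⟨⟨0, hd⟩⟩
  exact compl_mem_ae_iff.2 (measure_singleton 0)

/-- Integrability is transferred from the kernel of order `-a`, with no moments of Gaussians. -/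
theorem integrable_norm_rpow_mul_besselKernel (hd : 1 ≤ d) {a : ℝ} (ha : 0 < a) :
    Integrable (fun q : EuclideanSpace ℝ (Fin d) × ℝ => ‖q.1‖ ^ (2 * a) * besselKernel a q.2 q.1)
      (volume.prod (volume.restrict (Ioi 0))) := by
  have h := (integrable_prod_iff (measurable_besselKernel _).aestronglyMeasurable).1
    (integrable_besselKernel_neg (d := d) ha)
  have hm : Measurable (fun q : EuclideanSpace ℝ (Fin d) × ℝ =>
      ‖q.1‖ ^ (2 * a) * besselKernel a q.2 q.1) :=
    Measurable.mul (by fun_prop) (measurable_besselKernel _)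
  rw [integrable_prod_iff hm.aestronglyMeasurable]
  constructor
  · filter_upwards [h.1, ae_ne_zero hd] with ξ h1 hξ
    exact (integral_besselKernel_neg a hξ).1.2 h1
  · refine (h.2.const_mul (2 ^ (2 * a))).congr ?_
    filter_upwards [ae_ne_zero hd] with ξ hξ
    have h1 : ∀ b : ℝ, ∀ t ∈ Ioi (0 : ℝ), ‖besselKernel b t ξ‖ = besselKernel b t ξ :=
      fun b t ht => norm_of_nonneg (besselKernel_nonneg b ht ξ)
    have h2 : ∀ t ∈ Ioi (0 : ℝ), ‖‖ξ‖ ^ (2 * a) * besselKernel a t ξ‖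
        = ‖ξ‖ ^ (2 * a) * besselKernel a t ξ := by
      intro t ht
      rw [norm_mul, h1 a t ht, norm_of_nonneg (by positivity)]
    rw [setIntegral_congr_fun measurableSet_Ioi (h1 (-a)),
      setIntegral_congr_fun measurableSet_Ioi h2,
      (integral_besselKernel_neg a hξ).2]

/-- The Fourier inversion of `‖ξ‖ ^ (2 * a)` times the Bessel kernel of order `a`: the symmetry
in the order turns it into the inversion of the kernel of order `-a`. -/
theorem integral_cos_mul_norm_rpow_mul_besselKernel (hd : 1 ≤ d) {a : ℝ} (ha : 0 < a)
    (x : EuclideanSpace ℝ (Fin d)) :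
    ∫ q : EuclideanSpace ℝ (Fin d) × ℝ,
        cos (inner ℝ x q.1) * (‖q.1‖ ^ (2 * a) * besselKernel a q.2 q.1)
        ∂(volume.prod (volume.restrict (Ioi 0)))
      = 2 ^ (2 * a) * ((4 * π) ^ ((d : ℝ) / 2)
        * ((1 + ‖x‖ ^ 2) ^ (-((d : ℝ) / 2 + a)) * Gamma ((d : ℝ) / 2 + a))) := by
  have hm : AEStronglyMeasurable
      (fun q : EuclideanSpace ℝ (Fin d) × ℝ => cos (inner ℝ x q.1))
      (volume.prod (volume.restrict (Ioi 0))) :=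
    Continuous.aestronglyMeasurable (by fun_prop)
  have hb : ∀ᵐ q : EuclideanSpace ℝ (Fin d) × ℝ ∂(volume.prod (volume.restrict (Ioi 0))),
      ‖cos (inner ℝ x q.1)‖ ≤ 1 := Eventually.of_forall fun q => abs_cos_le_one _
  have i1 := (integrable_norm_rpow_mul_besselKernel hd ha).bdd_mul hm hb
  have i2 := (integrable_besselKernel_neg ha).bdd_mul hm hb
  have hp : 0 < (d : ℝ) / 2 + a := by positivity
  have e : ∀ᵐ ξ : EuclideanSpace ℝ (Fin d), ∫ t in Ioi (0 : ℝ),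
      cos (inner ℝ x ξ) * (‖ξ‖ ^ (2 * a) * besselKernel a t ξ)
        = 2 ^ (2 * a) * ∫ t in Ioi (0 : ℝ), cos (inner ℝ x ξ) * besselKernel (-a) t ξ := by
    filter_upwards [ae_ne_zero hd] with ξ hξ
    rw [integral_const_mul, (integral_besselKernel_neg a hξ).2, integral_const_mul]
    ring
  have e2 : ∀ t ∈ Ioi (0 : ℝ), ∫ ξ : EuclideanSpace ℝ (Fin d),
      cos (inner ℝ x ξ) * besselKernel (-a) t ξ
        = (4 * π) ^ ((d : ℝ) / 2)
          * (t ^ ((d : ℝ) / 2 + a - 1) * exp (-((1 + ‖x‖ ^ 2) * t))) := by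
    intro t ht
    simp only [mul_comm (cos _)]
    rw [integral_besselKernel_mul_cos (-a) ht, sub_neg_eq_add]
  rw [integral_prod _ i1, integral_congr_ae e, integral_const_mul, ← integral_prod _ i2,
    integral_prod_symm _ i2, setIntegral_congr_fun measurableSet_Ioi e2, integral_const_mul,
    integral_rpow_mul_exp_neg_mul hp (by positivity)]

/-- The second-order difference quotient of the multiquadric is absolutely integrable, also for
`1 ≤ α`, and its integral is the claimed value of the fractional Laplacian. -/
theorem integral_symm_difference_gmq (hd : 1 ≤ d) {α : ℝ} (hα0 : 0 < α) (hα2 : α < 2)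
    (hne : (d : ℝ) - α ≠ 0) (hΓ : Gamma ((d : ℝ) / 2 - α / 2) ≠ 0)
    (x : EuclideanSpace ℝ (Fin d)) :
    Integrable (fun z => (gmq d α x - (gmq d α (x + z) + gmq d α (x - z)) / 2)
      / ‖z‖ ^ ((d : ℝ) + α)) ∧
    fracLapConst d α * ∫ z, (gmq d α x - (gmq d α (x + z) + gmq d α (x - z)) / 2)
      / ‖z‖ ^ ((d : ℝ) + α) = gmqConst d α * gmq d (-α) x := by
  set s : ℝ := (d : ℝ) / 2 - α / 2 with hs
  have hd' : (1 : ℝ) ≤ d := by exact_mod_cast hd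
  have hs1 : -1 < s := by linarith
  have hs0 : s ≠ 0 := fun h => hne (by linarith)
  have hα : 0 < α / 2 := by linarith
  have hc := fracLapConst_pos (d := d) hα0 hα2
  have hπ : (0 : ℝ) < (4 * π) ^ ((d : ℝ) / 2) := by positivity
  let F : EuclideanSpace ℝ (Fin d) → EuclideanSpace ℝ (Fin d) × ℝ → ℝ := fun z q =>
    besselKernel (α / 2) q.2 q.1 * cos (inner ℝ x q.1)
      * ((1 - cos (inner ℝ q.1 z)) / ‖z‖ ^ ((d : ℝ) + α))
  -- `F z (ξ, t)` is integrated over `z` first, which yields the symbol `‖ξ‖ ^ α`, and then over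
  -- `(ξ, t)` first, which yields the second-order difference quotient at `z`.
  have hFz : ∀ q, ∫ z, F z q = (fracLapConst d α)⁻¹ * (cos (inner ℝ x q.1)
      * (‖q.1‖ ^ (2 * (α / 2)) * besselKernel (α / 2) q.2 q.1)) := by
    intro q
    simp only [F]
    rw [integral_const_mul, (integral_one_sub_cos_div_norm_rpow hα0 hα2 q.1).2,
      show 2 * (α / 2) = α by ring]
    field_simp
  have hFn : ∀ q, 0 < q.2 → ∫ z, ‖F z q‖ ≤ (fracLapConst d α)⁻¹
      * (‖q.1‖ ^ (2 * (α / 2)) * besselKernel (α / 2) q.2 q.1) := by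
    intro q hq
    have hk := besselKernel_nonneg (α / 2) hq q.1
    have e : ∀ z, ‖F z q‖ = (besselKernel (α / 2) q.2 q.1 * |cos (inner ℝ x q.1)|)
        * ((1 - cos (inner ℝ q.1 z)) / ‖z‖ ^ ((d : ℝ) + α)) := by
      intro z
      simp only [F]
      rw [norm_mul, norm_mul, norm_of_nonneg hk, norm_of_nonneg (div_nonneg
        (sub_nonneg.2 (cos_le_one _)) (by positivity)), norm_eq_abs]
    simp only [e]
    rw [integral_const_mul, (integral_one_sub_cos_div_norm_rpow hα0 hα2 q.1).2,
      show 2 * (α / 2) = α by ring]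
    have h1 : besselKernel (α / 2) q.2 q.1 * |cos (inner ℝ x q.1)|
        ≤ besselKernel (α / 2) q.2 q.1 := mul_le_of_le_one_right hk (abs_cos_le_one _)
    calc _ ≤ besselKernel (α / 2) q.2 q.1 * (‖q.1‖ ^ α / fracLapConst d α) := by gcongr
      _ = _ := by rw [div_eq_inv_mul]; ring
  have hpos : ∀ᵐ q : EuclideanSpace ℝ (Fin d) × ℝ
      ∂(volume.prod (volume.restrict (Ioi 0))), 0 < q.2 :=
    Measure.quasiMeasurePreserving_snd.ae (ae_restrict_mem measurableSet_Ioi)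
  have hFm : Measurable (Function.uncurry F) := by
    simp only [F, Function.uncurry_def, besselKernel]
    fun_prop
  have hint : Integrable (Function.uncurry F)
      (volume.prod (volume.prod (volume.restrict (Ioi 0)))) := by
    rw [integrable_prod_iff' hFm.aestronglyMeasurable]
    constructor
    · exact Eventually.of_forall fun q =>
        (integral_one_sub_cos_div_norm_rpow hα0 hα2 q.1).1.const_mul
          (besselKernel (α / 2) q.2 q.1 * cos (inner ℝ x q.1))
    · refine ((integrable_norm_rpow_mul_besselKernel hd hα).const_mul (fracLapConst d α)⁻¹).mono'
        hFm.norm.stronglyMeasurable.integral_prod_left'.aestronglyMeasurable ?_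
      filter_upwards [hpos] with q hq
      rw [norm_of_nonneg (integral_nonneg fun _ => norm_nonneg _)]
      exact hFn q hq
  have hFt : ∀ z, ∀ t ∈ Ioi (0 : ℝ), ∫ ξ, F z (ξ, t) = (4 * π) ^ ((d : ℝ) / 2)
      * ((t ^ (s - 1) * (exp (-((1 + ‖x‖ ^ 2) * t)) - exp (-((1 + ‖x + z‖ ^ 2) * t))))
        + (t ^ (s - 1) * (exp (-((1 + ‖x‖ ^ 2) * t)) - exp (-((1 + ‖x - z‖ ^ 2) * t)))))
      / (2 * ‖z‖ ^ ((d : ℝ) + α)) := by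
    intro z t ht
    -- The identity `cos u * cos v = (cos (u + v) + cos (u - v)) / 2` produces the translates.
    have e : ∀ ξ, F z (ξ, t) = (besselKernel (α / 2) t ξ * cos (inner ℝ x ξ)
        - (2⁻¹ * (besselKernel (α / 2) t ξ * cos (inner ℝ (x + z) ξ))
          + 2⁻¹ * (besselKernel (α / 2) t ξ * cos (inner ℝ (x - z) ξ)))) / ‖z‖ ^ ((d : ℝ) + α) := by
      intro ξ
      simp only [F]
      rw [inner_add_left, inner_sub_left, cos_add, cos_sub, real_inner_comm z ξ]
      ring
    have i := integrable_besselKernel_mul_cos (d := d) (α / 2) ht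
    have i2 : Integrable (fun ξ => 2⁻¹ * (besselKernel (α / 2) t ξ * cos (inner ℝ (x + z) ξ))
        + 2⁻¹ * (besselKernel (α / 2) t ξ * cos (inner ℝ (x - z) ξ))) :=
      ((i _).const_mul _).add ((i _).const_mul _)
    simp only [e]
    rw [integral_div, integral_sub (i x) i2,
      integral_add ((i _).const_mul _) ((i _).const_mul _), integral_const_mul,
      integral_const_mul, integral_besselKernel_mul_cos _ ht, integral_besselKernel_mul_cos _ ht,
      integral_besselKernel_mul_cos _ ht]
    ring
  have hgmq : ∀ y : EuclideanSpace ℝ (Fin d), gmq d α y = (1 + ‖y‖ ^ 2) ^ (-s) := by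
    intro y
    rw [gmq, hs, neg_sub]
  have hFq : ∀ᵐ z, ∫ q, F z q ∂(volume.prod (volume.restrict (Ioi 0)))
      = (4 * π) ^ ((d : ℝ) / 2) * Gamma s
        * ((gmq d α x - (gmq d α (x + z) + gmq d α (x - z)) / 2) / ‖z‖ ^ ((d : ℝ) + α)) := by
    filter_upwards [hint.prod_right_ae] with z hz
    obtain ⟨i1, e1⟩ := integral_rpow_mul_exp_sub_exp (A := 1 + ‖x‖ ^ 2) (B := 1 + ‖x + z‖ ^ 2)
      hs1 hs0 (by positivity) (by positivity)
    obtain ⟨i2, e2⟩ := integral_rpow_mul_exp_sub_exp (A := 1 + ‖x‖ ^ 2) (B := 1 + ‖x - z‖ ^ 2)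
      hs1 hs0 (by positivity) (by positivity)
    rw [integral_prod_symm (F z) hz]
    rw [setIntegral_congr_fun measurableSet_Ioi (hFt z), integral_div, integral_const_mul,
      integral_add i1 i2, e1, e2, hgmq, hgmq, hgmq]
    ring
  have hK : (4 * π) ^ ((d : ℝ) / 2) * Gamma s ≠ 0 := mul_ne_zero hπ.ne' hΓ
  constructor
  · have h1 := hint.integral_prod_left.congr hFq
    exact (integrable_const_mul_iff (IsUnit.mk0 _ hK) _).1 h1
  · have h2 := integral_integral_swap hint
    rw [integral_congr_ae hFq, integral_const_mul] at h2
    simp only [hFz] at h2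
    rw [integral_const_mul, integral_cos_mul_norm_rpow_mul_besselKernel hd hα,
      show 2 * (α / 2) = α by ring, eq_inv_mul_iff_mul_eq₀ hc.ne'] at h2
    rw [gmqConst, ← hs, show gmq d (-α) x = (1 + ‖x‖ ^ 2) ^ (-((d : ℝ) / 2 + α / 2)) by
      rw [gmq]; ring_nf]
    rw [div_mul_eq_mul_div, eq_div_iff hΓ]
    refine mul_left_cancel₀ hπ.ne' ?_
    linear_combination h2

end Fubini

/-! ### Absolute convergence and principal value -/

section PrincipalValue

variable {d : ℕ}

theorem nontrivial_euclideanSpace (hd : 1 ≤ d) : Nontrivial (EuclideanSpace ℝ (Fin d)) :=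
  have : Nonempty (Fin d) := ⟨⟨0, hd⟩⟩
  inferInstance

theorem pow_mul_rpow_of_one_le (hd : 1 ≤ d) {y : ℝ} (hy : 0 < y) (q : ℝ) :
    y ^ (d - 1) • y ^ q = y ^ ((d : ℝ) - 1 + q) := by
  rw [smul_eq_mul, rpow_add hy, ← rpow_natCast, Nat.cast_sub hd, Nat.cast_one]

theorem integrableOn_norm_rpow_ball (hd : 1 ≤ d) {q : ℝ} (hq : -(d : ℝ) < q) {r : ℝ} (hr : 0 < r) :
    IntegrableOn (fun z : EuclideanSpace ℝ (Fin d) => ‖z‖ ^ q) (Metric.ball 0 r) := by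
  have := nontrivial_euclideanSpace hd
  rw [integrableOn_fun_norm_addHaar volume (f := fun y => y ^ q), finrank_euclideanSpace_fin,
    integrableOn_congr_fun (fun y hy => pow_mul_rpow_of_one_le hd hy.1 q) measurableSet_Ioo,
    intervalIntegral.integrableOn_Ioo_rpow_iff hr]
  linarith

theorem measurableSet_lt_norm (ε : ℝ) :
    MeasurableSet {z : EuclideanSpace ℝ (Fin d) | ε < ‖z‖} :=
  measurableSet_lt measurable_const measurable_norm

theorem integrableOn_norm_rpow_compl_ball (hd : 1 ≤ d) {q : ℝ} (hq : q < -(d : ℝ)) {ε : ℝ}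
    (hε : 0 < ε) :
    IntegrableOn (fun z : EuclideanSpace ℝ (Fin d) => ‖z‖ ^ q) {z | ε < ‖z‖} := by
  have := nontrivial_euclideanSpace hd
  have e : {z : EuclideanSpace ℝ (Fin d) | ε < ‖z‖}.indicator (fun z => ‖z‖ ^ q)
      = fun z => (Ioi ε).indicator (fun y : ℝ => y ^ q) ‖z‖ := by
    ext z; simp [indicator]
  rw [← integrable_indicator_iff (measurableSet_lt_norm ε), e, integrable_fun_norm_addHaar volume,
    finrank_euclideanSpace_fin]
  have e2 : ∀ y ∈ Ioi (0 : ℝ), y ^ (d - 1) • (Ioi ε).indicator (fun y : ℝ => y ^ q) y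
      = (Ioi ε).indicator (fun y : ℝ => y ^ ((d : ℝ) - 1 + q)) y := by
    intro y hy
    by_cases h : ε < y
    · simp only [indicator, mem_Ioi, h, if_true]
      exact pow_mul_rpow_of_one_le hd hy q
    · simp [indicator, h]
  rw [integrableOn_congr_fun e2 measurableSet_Ioi]
  refine IntegrableOn.mono_set (t := univ) ?_ (subset_univ _)
  rw [integrableOn_univ, integrable_indicator_iff measurableSet_Ioi]
  exact integrableOn_Ioi_rpow_of_lt (by linarith) hε

theorem gmq_nonneg (α : ℝ) (y : EuclideanSpace ℝ (Fin d)) : 0 ≤ gmq d α y := by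
  unfold gmq; positivity

/-- For `d ≥ 1` and `0 < α < 2` the exponent `max (α - d) 0` is positive only if `d = 1 < α`, where the
multiquadric is unbounded; it is smaller than `α` in all cases. -/
theorem gmq_le (α : ℝ) (y : EuclideanSpace ℝ (Fin d)) :
    gmq d α y ≤ (1 + ‖y‖) ^ max (α - d) 0 := by
  have h1 : (1 : ℝ) ≤ 1 + ‖y‖ ^ 2 := by nlinarith [sq_nonneg ‖y‖]
  have hy := norm_nonneg y
  calc gmq d α y ≤ (1 + ‖y‖ ^ 2) ^ (max (α - d) 0 / 2) :=
        rpow_le_rpow_of_exponent_le h1 (by linarith [le_max_left (α - d) 0])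
    _ ≤ ((1 + ‖y‖) ^ 2) ^ (max (α - d) 0 / 2) :=
        rpow_le_rpow (by positivity) (by nlinarith) (by positivity)
    _ = _ := by
        rw [← rpow_natCast, ← rpow_mul (by positivity)]
        congr 1
        push_cast
        ring

theorem differentiable_gmq (α : ℝ) : Differentiable ℝ (gmq d α) := by
  have h : Differentiable ℝ fun x : EuclideanSpace ℝ (Fin d) => 1 + ‖x‖ ^ 2 :=
    (differentiable_const _).add ((contDiff_norm_sq ℝ (n := 1)).differentiable (by simp))
  exact fun x => (h x).rpow_const (Or.inl (by positivity))

theorem measurable_gmq_quotient (α : ℝ) (x : EuclideanSpace ℝ (Fin d)) :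
    Measurable fun z => (gmq d α x - gmq d α (x + z)) / ‖z‖ ^ ((d : ℝ) + α) := by
  unfold gmq; fun_prop

/-- Away from `z = 0` the quotient is `O(‖z‖ ^ (m - d - α))` with `m = max (α - d) 0 < α`. -/
theorem integrableOn_gmq_quotient (hd : 1 ≤ d) {α : ℝ} (hα0 : 0 < α)
    (x : EuclideanSpace ℝ (Fin d)) {ε : ℝ} (hε : 0 < ε) :
    IntegrableOn (fun z => (gmq d α x - gmq d α (x + z)) / ‖z‖ ^ ((d : ℝ) + α))
      {z | ε < ‖z‖} := by
  set m := max (α - d) 0 with hm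
  have hd' : (1 : ℝ) ≤ d := by exact_mod_cast hd
  have hmα : m < α := max_lt (by linarith) hα0
  have hm0 : 0 ≤ m := le_max_right _ _
  set K := (1 + ‖x‖) / ε + 1 with hK
  have hK0 : 0 < K := by positivity
  refine ((integrableOn_norm_rpow_compl_ball hd (q := m - (d + α)) (by linarith) hε).const_mul
    (K ^ m)).mono' (measurable_gmq_quotient α x).aestronglyMeasurable ?_
  filter_upwards [ae_restrict_mem (measurableSet_lt_norm ε)] with z hz
  have hz' : 0 < ‖z‖ := hε.trans hz
  have hKz : 1 + ‖x‖ + ‖z‖ ≤ K * ‖z‖ := by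
    have : 1 + ‖x‖ ≤ (1 + ‖x‖) / ε * ‖z‖ := by
      rw [div_mul_eq_mul_div, le_div_iff₀ hε]
      exact mul_le_mul_of_nonneg_left (le_of_lt hz) (by positivity)
    rw [hK]; linarith
  have hb : ∀ y : EuclideanSpace ℝ (Fin d), ‖y‖ ≤ ‖x‖ + ‖z‖ → gmq d α y ≤ K ^ m * ‖z‖ ^ m := by
    intro y hy
    rw [← mul_rpow hK0.le hz'.le]
    exact (gmq_le α y).trans (rpow_le_rpow (by positivity) (by linarith) hm0)
  have h1 := hb x (by linarith)
  have h2 := hb (x + z) (norm_add_le x z)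
  rw [norm_div, norm_of_nonneg (by positivity : 0 ≤ ‖z‖ ^ ((d : ℝ) + α)), rpow_sub hz',
    ← mul_div_assoc, norm_eq_abs]
  gcongr
  rw [abs_le]
  constructor <;> linarith [gmq_nonneg α x, gmq_nonneg α (x + z)]

/-- Near `z = 0` the quotient is `O(‖z‖ ^ (1 - d - α))`, which is integrable for `α < 1`. -/
theorem integrable_gmq_quotient (hd : 1 ≤ d) {α : ℝ} (hα0 : 0 < α) (hα1 : α < 1)
    (x : EuclideanSpace ℝ (Fin d)) :
    Integrable (fun z => (gmq d α x - gmq d α (x + z)) / ‖z‖ ^ ((d : ℝ) + α)) := by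
  obtain ⟨C, hC⟩ := (differentiable_gmq α x).isBigO_sub.bound
  obtain ⟨r, hr, hball⟩ := Metric.eventually_nhds_iff.1 hC
  have hnear : IntegrableOn (fun z => (gmq d α x - gmq d α (x + z)) / ‖z‖ ^ ((d : ℝ) + α))
      (Metric.ball 0 r) := by
    refine ((integrableOn_norm_rpow_ball hd (q := 1 - (d + α)) (by linarith) hr).const_mul
      C).mono' (measurable_gmq_quotient α x).aestronglyMeasurable ?_
    filter_upwards [ae_restrict_mem measurableSet_ball, ae_restrict_of_ae (ae_ne_zero hd)]
      with z hz hz0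
    have hz0 : 0 < ‖z‖ := norm_pos_iff.2 hz0
    have h := hball (y := x + z) (by simpa using hz)
    rw [add_sub_cancel_left, norm_sub_rev] at h
    rw [norm_div, norm_of_nonneg (by positivity : 0 ≤ ‖z‖ ^ ((d : ℝ) + α)), rpow_sub hz0,
      rpow_one, ← mul_div_assoc]
    gcongr
  have hfar := integrableOn_gmq_quotient hd hα0 x (half_pos hr)
  rw [← integrableOn_univ]
  refine (hnear.union hfar).mono_set fun z _ => ?_
  by_cases h : ‖z‖ < r
  · exact Or.inl (by simpa using h)
  · exact Or.inr (by simp only [mem_ofPred_eq]; linarith)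

/-- On a set invariant under `z ↦ -z`, the quotient may be replaced by its even part. -/
theorem setIntegral_gmq_quotient_eq_symm {α : ℝ} (x : EuclideanSpace ℝ (Fin d))
    {s : Set (EuclideanSpace ℝ (Fin d))} (hs : MeasurableSet s) (hneg : ∀ z, -z ∈ s ↔ z ∈ s)
    (hi : IntegrableOn (fun z => (gmq d α x - gmq d α (x + z)) / ‖z‖ ^ ((d : ℝ) + α)) s) :
    ∫ z in s, (gmq d α x - gmq d α (x + z)) / ‖z‖ ^ ((d : ℝ) + α)
      = ∫ z in s, (gmq d α x - (gmq d α (x + z) + gmq d α (x - z)) / 2)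
        / ‖z‖ ^ ((d : ℝ) + α) := by
  set g := fun z => (gmq d α x - gmq d α (x + z)) / ‖z‖ ^ ((d : ℝ) + α) with hg
  have hi' : Integrable (s.indicator g) := (integrable_indicator_iff hs).2 hi
  have h := integral_add hi' hi'.comp_neg
  rw [integral_neg_eq_self (s.indicator g) volume] at h
  have e : (fun z => s.indicator g z + s.indicator g (-z)) = fun z => 2 *
      s.indicator (fun z => (gmq d α x - (gmq d α (x + z) + gmq d α (x - z)) / 2)
        / ‖z‖ ^ ((d : ℝ) + α)) z := by
    ext z
    by_cases hz : z ∈ s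
    · rw [indicator_of_mem hz, indicator_of_mem ((hneg z).2 hz), indicator_of_mem hz]
      simp only [hg, norm_neg, ← sub_eq_add_neg]
      ring
    · rw [indicator_of_notMem hz, indicator_of_notMem fun h => hz ((hneg z).1 h),
        indicator_of_notMem hz]
      ring
  rw [e, integral_const_mul, integral_indicator hs, integral_indicator hs] at h
  linarith

theorem fracLapIntegrand_gmq_eq (α : ℝ) (x y : EuclideanSpace ℝ (Fin d)) :
    fracLapIntegrand α (gmq d α) x y
      = (gmq d α x - gmq d α (x + (y - x))) / ‖y - x‖ ^ ((d : ℝ) + α) := by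
  rw [fracLapIntegrand, add_sub_cancel, norm_sub_rev]

theorem hasPrincipalValueAt_fracLapIntegrand_gmq (hd : 1 ≤ d) {α : ℝ} (hα0 : 0 < α)
    (x : EuclideanSpace ℝ (Fin d))
    (hD : Integrable (fun z => (gmq d α x - (gmq d α (x + z) + gmq d α (x - z)) / 2)
      / ‖z‖ ^ ((d : ℝ) + α))) :
    HasPrincipalValueAt (fracLapIntegrand α (gmq d α) x) x
      (∫ z, (gmq d α x - (gmq d α (x + z) + gmq d α (x - z)) / 2) / ‖z‖ ^ ((d : ℝ) + α)) := by
  set g := fun z => (gmq d α x - gmq d α (x + z)) / ‖z‖ ^ ((d : ℝ) + α) with hg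
  set D := fun z => (gmq d α x - (gmq d α (x + z) + gmq d α (x - z)) / 2) / ‖z‖ ^ ((d : ℝ) + α)
  have hset : ∀ ε : ℝ, MeasurableSet {y : EuclideanSpace ℝ (Fin d) | ε < ‖x - y‖} := fun ε =>
    measurableSet_lt measurable_const (by fun_prop)
  have he : ∀ ε : ℝ, {y | ε < ‖x - y‖}.indicator (fracLapIntegrand α (gmq d α) x)
      = fun y => {z | ε < ‖z‖}.indicator g (y - x) := by
    intro ε
    ext y
    simp only [indicator, mem_ofPred_eq, fracLapIntegrand_gmq_eq, norm_sub_rev x y, hg]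
  have hgi : ∀ ε : ℝ, 0 < ε → IntegrableOn g {z | ε < ‖z‖} := fun ε hε =>
    integrableOn_gmq_quotient hd hα0 x hε
  refine ⟨fun ε hε => ?_, ?_⟩
  · rw [← integrable_indicator_iff (hset ε), he]
    exact ((integrable_indicator_iff (measurableSet_lt_norm ε)).2 (hgi ε hε)).comp_sub_right x
  · have hval : ∀ ε : ℝ, 0 < ε → ∫ y in {y | ε < ‖x - y‖}, fracLapIntegrand α (gmq d α) x y
        = ∫ z, {z | ε < ‖z‖}.indicator D z := by
      intro ε hε
      rw [← integral_indicator (hset ε), he, integral_sub_right_eq_self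
        ({z | ε < ‖z‖}.indicator g) x, integral_indicator (measurableSet_lt_norm ε),
        integral_indicator (measurableSet_lt_norm ε)]
      exact setIntegral_gmq_quotient_eq_symm x (measurableSet_lt_norm ε) (by simp) (hgi ε hε)
    have hlim : Tendsto (fun ε : ℝ => ∫ z, {z | ε < ‖z‖}.indicator D z) (𝓝[>] 0) (𝓝 (∫ z, D z)) := by
      refine tendsto_integral_filter_of_dominated_convergence (fun z => ‖D z‖)
        (Eventually.of_forall fun ε =>
          hD.aestronglyMeasurable.indicator (measurableSet_lt_norm ε))
        (Eventually.of_forall fun ε => Eventually.of_forall fun z => norm_indicator_le_norm_self _ _)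
        hD.norm ?_
      filter_upwards [ae_ne_zero hd] with z hz
      refine tendsto_const_nhds.congr' ?_
      filter_upwards [mem_nhdsWithin_of_mem_nhds (Iio_mem_nhds (norm_pos_iff.2 hz))] with ε hε
      exact (indicator_of_mem (s := {z | ε < ‖z‖}) hε D).symm
    refine hlim.congr' ?_
    filter_upwards [self_mem_nhdsWithin] with ε hε using (hval ε hε).symm

end PrincipalValue

theorem theorem2p1 (d : ℕ) (hd : 1 ≤ d) (α : ℝ) (hα0 : 0 < α) (hα2 : α < 2)
    (h : 0 < (d : ℝ) - α ∨ ¬ ∃ k : ℤ, (d : ℝ) - α = 2 * (k : ℝ)) :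
    ∀ x : EuclideanSpace ℝ (Fin d),
      HasFracLaplacianAt α (gmq d α) (gmqConst d α * gmq d (-α) x) x := by
  intro x
  -- `(d - α) / 2` is not a pole of `Γ`, so the quotient by `Γ((d - α) / 2)` in `gmqConst` is genuine.
  have hpole : ∀ m : ℕ, (d : ℝ) / 2 - α / 2 ≠ -m := by
    intro m hm
    rcases h with h | h
    · have : (0 : ℝ) ≤ m := m.cast_nonneg
      linarith
    · exact h ⟨-m, by push_cast; linarith⟩
  have hne : (d : ℝ) - α ≠ 0 := fun h0 => hpole 0 (by push_cast; linarith)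
  obtain ⟨hD, hval⟩ := integral_symm_difference_gmq hd hα0 hα2 hne (Gamma_ne_zero hpole) x
  refine ⟨fun hα1 => ?_, fun _ => ⟨_, hasPrincipalValueAt_fracLapIntegrand_gmq hd hα0 x hD,
    hval.symm⟩⟩
  have hg := integrable_gmq_quotient hd hα0 hα1 x
  have he : fracLapIntegrand α (gmq d α) x = fun y =>
      (fun z => (gmq d α x - gmq d α (x + z)) / ‖z‖ ^ ((d : ℝ) + α)) (y - x) :=
    funext fun y => fracLapIntegrand_gmq_eq α x y
  have hsymm := setIntegral_gmq_quotient_eq_symm x MeasurableSet.univ (by simp)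
    (integrableOn_univ.2 hg)
  rw [setIntegral_univ, setIntegral_univ] at hsymm
  rw [he]
  refine ⟨hg.comp_sub_right x, ?_⟩
  rw [integral_sub_right_eq_self
    (fun z => (gmq d α x - gmq d α (x + z)) / ‖z‖ ^ ((d : ℝ) + α)) x, hsymm, hval]
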